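/- Let $A=(a_{ij})$ be an $n\times n$ matrix with entries in $\mathbb R_+=[0,\infty)$. Matrix products and powers $A^t$ are taken in max-times algebra: $(A\otimes B)_{ij}=\max_k a_{ik}b_{kj}$, $(A\otimes y)_i=\max_k a_{ik}y_k$, $A^0=I$, and $a\oplus b=\max(a,b)$ (componentwise for vectors). We write $A^ty$ for $A^t\otimes y$. Let $D(A)$ be the digraph with nodes $1,\dots,n$ and an edge $(i,j)$ whenever $a_{ij}\neq 0$. A path may repeat nodes, and its length is its number of edges. The weight $w(P)$ of a path $P$ is the product of the entries $a_{ij}$ over its edges. A cycle is a path of length at least $1$ whose first and last nodes coincide. It is simple if it repeats no other node. Nodes $i,j$ are in the same component of $D(A)$ if each can be connected to the other by a path (of length $\ge 0$). A component is nontrivial if its nodes belong to cycles; a node that belongs to no cycle forms a trivial component. Let $L$ be the set of nodes in nontrivial components. The maximum cycle geometric mean of a component is the maximum of $w(P)^{1/k}$ over all cycles $P$ in it, where $k$ is the length of $P$. For a node $i$, let $\lambda(i)$ be the maximum cycle geometric mean of the component of $i$ if $i\in L$, and $\lambda(i)=0$ otherwise. The critical digraph of a nontrivial component consists of all nodes and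 edges of the cycles in it that attain this maximum. The cyclicity of a strongly connected digraph with at least one edge is the greatest common divisor of the lengths of its simple cycles. Let $\gamma$ be the least common multiple of the cyclicities of all strongly connected components of the critical digraphs of all nontrivial components of $D(A)$ ($\gamma=1$ if there are none). For $y\in\mathbb R_+^n$, the sequence $\{A^ty,\ t\ge 0\}$ is called ultimately linear periodic if there is $\lambda(y)\in\mathbb R_+$ such that $A^{t+\gamma}y=\lambda(y)^{\gamma}A^ty$ for all sufficiently large $t$. The matrix $A$ is called orbit periodic if $\{A^ty,\ t\ge 0\}$ is ultimately linear periodic for every $y\in\mathbb R_+^n$. We say that $i$ accesses $j$ if some path connects $i$ to $j$, and that $i$ strongly accesses $j$ if there is $T_{ij}$ such that for every $t\ge T_{ij}$ some path of length $t$ connects $i$ to $j$. Let $e_i$ be the $i$-th unit vector. **Theorem (Orbit periodicity).** $A$ is orbit periodic if and only if the following conditions hold for all $i,j\in L$: 1. if $i$ accesses $j$, then $\lambda(i)\le\lambda(j)$; 2. if neither $j$ strongly accesses $i$ nor $i$ strongly accesses $j$, then $\lambda(i)=\lambda(j)$. Equivalently, $A$ is orbit periodic if and only if $\{A^t(e_i\oplus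 e_j),\ t\ge 0\}$ is ultimately linear periodic for all $i,j\in L$. -/

import Mathlib

open scoped NNReal

noncomputable section

namespace MaxAlgebra

/-! ### Digraphs -/

/-- `p 0, p 1, …, p t` is a path of length `t` (number of edges) in `G`; nodes may be repeated. -/
def IsPath {V : Type*} (G : Digraph V) {t : ℕ} (p : Fin (t + 1) → V) : Prop :=
  ∀ s : Fin t, G.Adj (p s.castSucc) (p s.succ)

/-- The node `i` can be connected to the node `j` by a path of length `t`. -/
def HasPath {V : Type*} (G : Digraph V) (t : ℕ) (i j : V) : Prop :=
  ∃ p : Fin (t + 1) → V, IsPath G p ∧ p 0 = i ∧ p (Fin.last t) = j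

/-- `i` accesses `j`: some path connects `i` to `j`. -/
def Accesses {V : Type*} (G : Digraph V) (i j : V) : Prop :=
  ∃ t : ℕ, HasPath G t i j

/-- `i` strongly accesses `j`: paths of all sufficiently large lengths connect `i` to `j`. -/
def StronglyAccesses {V : Type*} (G : Digraph V) (i j : V) : Prop :=
  ∃ T : ℕ, ∀ t : ℕ, T ≤ t → HasPath G t i j

/-- `i` and `j` lie in the same (strongly connected) component. -/
def SameComponent {V : Type*} (G : Digraph V) (i j : V) : Prop :=
  Accesses G i j ∧ Accesses G j i

/-- A cycle of length `k ≥ 1`, written as a path whose last node is its first node. -/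
def IsCycle {V : Type*} (G : Digraph V) {k : ℕ} (p : Fin (k + 1) → V) : Prop :=
  1 ≤ k ∧ IsPath G p ∧ p 0 = p (Fin.last k)

/-- A simple cycle: the nodes `p 0, …, p (k - 1)` are pairwise distinct. -/
def IsSimpleCycle {V : Type*} (G : Digraph V) {k : ℕ} (p : Fin (k + 1) → V) : Prop :=
  IsCycle G p ∧ Function.Injective fun s : Fin k => p s.castSucc

/-- The node `i` belongs to a cycle, i.e. to a nontrivial component. -/
def OnCycle {V : Type*} (G : Digraph V) (i : V) : Prop :=
  ∃ k : ℕ, 1 ≤ k ∧ HasPath G k i i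

/-- The cyclicity of the component of `i`: the g.c.d. of the lengths of its simple cycles. -/
def componentCyclicity {V : Type*} (G : Digraph V) (i : V) : ℕ :=
  Nat.setGcd {k : ℕ | ∃ p : Fin (k + 1) → V, IsSimpleCycle G p ∧ SameComponent G i (p 0)}

open Classical in
/-- The cyclicity of a digraph: the l.c.m. of the cyclicities of its nontrivial components
(`1` if there are none). -/
def cyclicity {V : Type*} [Fintype V] (G : Digraph V) : ℕ :=
  (Finset.univ.filter fun i => OnCycle G i).lcm (componentCyclicity G)

/-! ### Max algebra -/

/-- The max-algebraic product of matrices: `(A ⊗ B) i j = max_k (A i k * B k j)`. -/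
def mul {n : ℕ} (A B : Matrix (Fin n) (Fin n) ℝ≥0) : Matrix (Fin n) (Fin n) ℝ≥0 :=
  Matrix.of fun i j => Finset.univ.sup fun k => A i k * B k j

/-- The max-algebraic product of a matrix and a vector: `(A ⊗ y) i = max_k (A i k * y k)`. -/
def mulVec {n : ℕ} (A : Matrix (Fin n) (Fin n) ℝ≥0) (y : Fin n → ℝ≥0) : Fin n → ℝ≥0 :=
  fun i => Finset.univ.sup fun k => A i k * y k

/-- Max-algebraic powers of a matrix. -/
def pow {n : ℕ} (A : Matrix (Fin n) (Fin n) ℝ≥0) : ℕ → Matrix (Fin n) (Fin n) ℝ≥0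
  | 0 => 1
  | t + 1 => mul (pow A t) A

/-- The digraph associated with `A`: there is an edge `(i, j)` iff `A i j ≠ 0`. -/
def digraph {n : ℕ} (A : Matrix (Fin n) (Fin n) ℝ≥0) : Digraph (Fin n) where
  Adj i j := A i j ≠ 0

/-- The weight of a path: the product of the weights of its edges. -/
def weight {n : ℕ} (A : Matrix (Fin n) (Fin n) ℝ≥0) {t : ℕ} (p : Fin (t + 1) → Fin n) : ℝ≥0 :=
  ∏ s : Fin t, A (p s.castSucc) (p s.succ)

open Classical in
/-- The maximum cycle geometric mean of `A`: the maximum of `w(P) ^ (1 / k)` over the cycles `P`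
of length `k = 1, …, n` in the digraph of `A` (`0` if there are no cycles). -/
def mcgm {n : ℕ} (A : Matrix (Fin n) (Fin n) ℝ≥0) : ℝ≥0 :=
  (Finset.Icc 1 n).sup fun k =>
    (Finset.univ.filter fun p : Fin (k + 1) → Fin n => IsCycle (digraph A) p).sup fun p =>
      weight A p ^ (1 / (k : ℝ))

/-- The critical digraph of `A`: its edges are those of the critical cycles of `A`, that is, of the
cycles whose geometric mean is `mcgm A`. -/
def criticalDigraph {n : ℕ} (A : Matrix (Fin n) (Fin n) ℝ≥0) : Digraph (Fin n) where
  Adj i j := ∃ (k : ℕ) (p : Fin (k + 1) → Fin n), IsCycle (digraph A) p ∧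
    weight A p ^ (1 / (k : ℝ)) = mcgm A ∧ ∃ s : Fin k, p s.castSucc = i ∧ p s.succ = j

open Classical in
/-- The part of `A` carried by the component of the node `i`: all entries outside the rows and
columns of this component are replaced by `0`. -/
def componentMatrix {n : ℕ} (A : Matrix (Fin n) (Fin n) ℝ≥0) (i : Fin n) :
    Matrix (Fin n) (Fin n) ℝ≥0 :=
  Matrix.of fun k l =>
    if SameComponent (digraph A) i k ∧ SameComponent (digraph A) i l then A k l else 0

/-- `λ(i)`: the maximum cycle geometric mean of the component of `i` (`0` if it is trivial). -/
def nodeMcgm {n : ℕ} (A : Matrix (Fin n) (Fin n) ℝ≥0) (i : Fin n) : ℝ≥0 :=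
  mcgm (componentMatrix A i)

/-- The joint cyclicity (l.c.m.) of the critical digraphs of all components of the digraph
of `A`; a trivial component contributes `1`. -/
def jointCyclicity {n : ℕ} (A : Matrix (Fin n) (Fin n) ℝ≥0) : ℕ :=
  Finset.univ.lcm fun i : Fin n => cyclicity (criticalDigraph (componentMatrix A i))

/-- The orbit `A^t ⊗ y`, `t ≥ 0`, is ultimately linear periodic, with ultimate growth rate `r`:
`A^(t+γ) ⊗ y = r^γ (A^t ⊗ y)` for all large `t`, where `γ` is the joint cyclicity. -/
def UltimatelyLinearPeriodic {n : ℕ} (A : Matrix (Fin n) (Fin n) ℝ≥0) (y : Fin n → ℝ≥0) : Prop :=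
  ∃ r : ℝ≥0, ∃ T : ℕ, ∀ t : ℕ, T ≤ t →
    mulVec (pow A (t + jointCyclicity A)) y = r ^ jointCyclicity A • mulVec (pow A t) y

/-- `A` is orbit periodic: all its orbits are ultimately linear periodic. -/
def OrbitPeriodic {n : ℕ} (A : Matrix (Fin n) (Fin n) ℝ≥0) : Prop :=
  ∀ y : Fin n → ℝ≥0, UltimatelyLinearPeriodic A y

/-- The `i`-th unit vector. -/
def unitVec {n : ℕ} (i : Fin n) : Fin n → ℝ≥0 := Pi.single i 1

end MaxAlgebra

end

namespace MaxAlgebra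

/-! ### Paths in digraphs -/

section Paths

variable {V : Type*} {G : Digraph V}

/-! The entry of `pow A t` at `(i, k)` is the largest weight of a path of length `t` from `i` to
`k`, so the whole argument is surgery on paths: a long path repeats a node, and the closed piece in
between can be cut out or replaced.

Sufficiency. Let μ be the largest λ among the nodes that access the support of `y`. If μ = 0 the
orbit dies out; otherwise rescale to μ = 1. At a critical node (one on a closed path of weight 1)
all large multiples of γ are lengths of closed paths of weight 1. A path through such a node can
therefore be shortened, keeping its length modulo γ, and padded to any large length in the same
class without losing weight (`exists_forall_mul_le`). Paths avoiding these nodes decay to 0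
(`exists_forall_pow_lt`), so they are irrelevant as soon as each of them has a competitor of equal
length through a critical node; then the orbit is periodic (`exists_forall_mulVec_pow_add_eq`). The
two conditions supply the competitor. A long path meets a node `l` on a cycle. If λ(l) = μ, the path
is rerouted inside the component of `l`. If λ(l) < μ, the conditions force `l` to strongly access a
node `j` with λ(j) = μ, and a path of the right length goes through the component of `j`.

Necessity. All coordinates of a periodic orbit share one growth rate. Suitable coordinates of the
orbits of `e_i ⊕ e_j` see only closed paths at one node, hence have rate λ of that node
(`nodeMcgm_eq_of_periodic`), or dominate such paths (`nodeMcgm_le_of_periodic`). Comparing two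
coordinates gives both conditions. -/

lemma hasPath_iff_seq {t : ℕ} {i j : V} :
    HasPath G t i j ↔ ∃ q : ℕ → V, q 0 = i ∧ q t = j ∧ ∀ s < t, G.Adj (q s) (q (s + 1)) := by
  constructor
  · rintro ⟨p, hp, h0, ht⟩
    refine ⟨fun s => if h : s < t + 1 then p ⟨s, h⟩ else i, ?_, ?_, ?_⟩
    · simpa using h0
    · simpa [Fin.last] using ht
    · intro s hs
      have h1 : s < t + 1 := by omega
      have h2 : s + 1 < t + 1 := by omega
      simp only [h1, h2, dif_pos]
      exact hp ⟨s, hs⟩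
  · rintro ⟨q, h0, ht, hq⟩
    exact ⟨fun s => q s, fun s => hq s s.2, h0, ht⟩

lemma hasPath_zero {i j : V} : HasPath G 0 i j ↔ i = j := by
  rw [hasPath_iff_seq]
  constructor
  · rintro ⟨q, rfl, rfl, -⟩
    rfl
  · rintro rfl
    exact ⟨fun _ => i, rfl, rfl, by simp⟩

lemma hasPath_succ {t : ℕ} {i j : V} :
    HasPath G (t + 1) i j ↔ ∃ l, HasPath G t i l ∧ G.Adj l j := by
  simp only [hasPath_iff_seq]
  constructor
  · rintro ⟨q, rfl, rfl, hq⟩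
    exact ⟨q t, ⟨q, rfl, rfl, fun s hs => hq s (by omega)⟩, hq t (by omega)⟩
  · rintro ⟨_, ⟨q, rfl, rfl, hq⟩, hj⟩
    refine ⟨fun s => if s ≤ t then q s else j, by simp, by simp, fun s hs => ?_⟩
    rcases Nat.lt_or_ge s t with h | h
    · simpa [h.le, Nat.succ_le_of_lt h] using hq s h
    · obtain rfl : s = t := by omega
      simpa using hj

lemma hasPath_add {a b : ℕ} {i j : V} :
    HasPath G (a + b) i j ↔ ∃ l, HasPath G a i l ∧ HasPath G b l j := by
  induction b generalizing j with
  | zero => simp [hasPath_zero]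
  | succ b ih =>
    rw [← add_assoc]
    simp only [hasPath_succ, ih]
    constructor
    · rintro ⟨m, ⟨l, h1, h2⟩, h3⟩
      exact ⟨l, h1, m, h2, h3⟩
    · rintro ⟨l, h1, m, h2, h3⟩
      exact ⟨m, ⟨l, h1, h2⟩, h3⟩

lemma HasPath.trans {a b : ℕ} {i l j : V} (h : HasPath G a i l) (h' : HasPath G b l j) :
    HasPath G (a + b) i j :=
  hasPath_add.2 ⟨l, h, h'⟩

lemma HasPath.mul_left {m : ℕ} {v : V} (h : HasPath G m v v) (r : ℕ) : HasPath G (r * m) v v := by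
  induction r with
  | zero => simp [hasPath_zero]
  | succ r ih => simpa [add_mul] using ih.trans h

lemma HasPath.accesses {t : ℕ} {i j : V} (h : HasPath G t i j) : Accesses G i j := ⟨t, h⟩

lemma Accesses.refl (i : V) : Accesses G i i := ⟨0, hasPath_zero.2 rfl⟩

lemma Accesses.trans {i l j : V} (h : Accesses G i l) (h' : Accesses G l j) : Accesses G i j := by
  obtain ⟨a, ha⟩ := h
  obtain ⟨b, hb⟩ := h'
  exact ⟨a + b, ha.trans hb⟩

lemma StronglyAccesses.trans {i l j : V} (h : StronglyAccesses G i l) (h' : Accesses G l j) :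
    StronglyAccesses G i j := by
  obtain ⟨T, hT⟩ := h
  obtain ⟨b, hb⟩ := h'
  refine ⟨T + b, fun t ht => ?_⟩
  obtain ⟨s, rfl⟩ := Nat.exists_eq_add_of_le ht
  have := (hT (T + s) (by omega)).trans hb
  rwa [show T + s + b = T + b + s by omega] at this

lemma StronglyAccesses.accesses {i j : V} (h : StronglyAccesses G i j) : Accesses G i j := by
  obtain ⟨T, hT⟩ := h
  exact ⟨T, hT T le_rfl⟩

lemma SameComponent.refl (i : V) : SameComponent G i i := ⟨.refl i, .refl i⟩

lemma SameComponent.symm {i j : V} (h : SameComponent G i j) : SameComponent G j i := ⟨h.2, h.1⟩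

lemma SameComponent.trans {i j l : V} (h : SameComponent G i j) (h' : SameComponent G j l) :
    SameComponent G i l := ⟨h.1.trans h'.1, h'.2.trans h.2⟩

lemma SameComponent.onCycle {i j : V} (h : SameComponent G i j) (hi : OnCycle G i) :
    OnCycle G j := by
  obtain ⟨k, hk, hp⟩ := hi
  obtain ⟨⟨a, ha⟩, b, hb⟩ := h
  exact ⟨b + k + a, by omega, (hb.trans hp).trans ha⟩

/-- The g.c.d. of the lengths of the closed paths through a node. -/
noncomputable def period (G : Digraph V) (v : V) : ℕ := Nat.setGcd {m | HasPath G m v v}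

/-- Splicing the closed path at `u` into a round trip from `v` through `u` lengthens it by `m`, so
`m` is a difference of closed path lengths at `v`. -/
lemma period_dvd {m : ℕ} {v u : V} (h : SameComponent G v u) (hm : HasPath G m u u) :
    period G v ∣ m := by
  obtain ⟨⟨a, ha⟩, b, hb⟩ := h
  have h1 : period G v ∣ a + b := Nat.setGcd_dvd_of_mem (ha.trans hb)
  have h2 : period G v ∣ a + m + b := Nat.setGcd_dvd_of_mem ((ha.trans hm).trans hb)
  rw [show a + m + b = (a + b) + m by omega] at h2
  exact (Nat.dvd_add_right h1).1 h2

/-- Closed path lengths at `v` form an additive monoid, and a monoid of naturals contains all large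
multiples of its g.c.d. -/
lemma exists_forall_hasPath_of_period_dvd (v : V) :
    ∃ T, ∀ m, T ≤ m → period G v ∣ m → HasPath G m v v := by
  obtain ⟨T, hT⟩ := Nat.exists_mem_closure_of_ge {m | HasPath G m v v}
  refine ⟨T, fun m hm hd => ?_⟩
  have := hT m hm hd
  clear hm hd
  induction this using AddSubmonoid.closure_induction with
  | mem x hx => exact hx
  | zero => exact hasPath_zero.2 rfl
  | add x y _ _ hx hy => exact hx.trans hy

lemma OnCycle.period_ne_zero {v : V} (h : OnCycle G v) : period G v ≠ 0 := by
  obtain ⟨k, hk, hp⟩ := h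
  have : period G v ∣ k := Nat.setGcd_dvd_of_mem hp
  rintro h0
  rw [h0, zero_dvd_iff] at this
  omega

lemma IsCycle.hasPath {k : ℕ} {p : Fin (k + 1) → V} (h : IsCycle G p) :
    HasPath G k (p 0) (p 0) := ⟨p, h.2.1, rfl, h.2.2.symm⟩

/-- Only this direction is needed: γ merely has to be a multiple of the periods. -/
lemma period_dvd_componentCyclicity (v : V) : period G v ∣ componentCyclicity G v := by
  refine Nat.dvd_setGcd_iff.2 ?_
  rintro k ⟨p, hp, hv⟩
  exact period_dvd hv hp.1.hasPath

/-- A shortest closed path through `v` is simple, since a repeated node would allow a shortcut. This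
keeps `componentCyclicity` from being the g.c.d. of an empty set, which is `0`. -/
lemma OnCycle.exists_isSimpleCycle {v : V} (h : OnCycle G v) :
    ∃ (k : ℕ) (p : Fin (k + 1) → V), IsSimpleCycle G p ∧ p 0 = v := by
  classical
  obtain ⟨hk, hp⟩ := Nat.find_spec h
  set k := Nat.find h
  have hmin : ∀ m, 1 ≤ m → HasPath G m v v → k ≤ m := fun m h1 h2 => Nat.find_min' h ⟨h1, h2⟩
  obtain ⟨q, h0, hk', hq⟩ := hasPath_iff_seq.1 hp
  have key : ∀ a b, a < b → b < k → q a ≠ q b := by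
    intro a b hab hb he
    have h1 : HasPath G a v (q a) :=
      hasPath_iff_seq.2 ⟨q, h0, rfl, fun s hs => hq s (by omega)⟩
    have h2 : HasPath G (k - b) (q b) v :=
      hasPath_iff_seq.2 ⟨fun s => q (b + s), rfl, by simpa [Nat.add_sub_cancel' hb.le] using hk',
        fun s hs => hq (b + s) (by omega)⟩
    rw [← he] at h2
    have := hmin _ (by omega) (h1.trans h2)
    omega
  refine ⟨k, fun s => q s, ⟨⟨hk, fun s => hq s s.2, ?_⟩, ?_⟩, h0⟩
  · simp [h0, hk']
  · intro a b hab
    simp only [Fin.val_castSucc] at hab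
    rcases lt_trichotomy (a : ℕ) b with h1 | h1 | h1
    · exact absurd hab (key _ _ h1 b.2)
    · exact Fin.ext h1
    · exact absurd hab.symm (key _ _ h1 a.2)

lemma OnCycle.componentCyclicity_ne_zero {v : V} (h : OnCycle G v) :
    componentCyclicity G v ≠ 0 := by
  obtain ⟨k, p, hp, rfl⟩ := h.exists_isSimpleCycle
  have : componentCyclicity G (p 0) ∣ k := Nat.setGcd_dvd_of_mem ⟨p, hp, .refl _⟩
  intro h0
  rw [h0, zero_dvd_iff] at this
  have := hp.1.1
  omega

lemma cyclicity_ne_zero [Fintype V] : cyclicity G ≠ 0 := by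
  classical
  rw [cyclicity, Finset.lcm_ne_zero_iff]
  intro v hv
  exact OnCycle.componentCyclicity_ne_zero (Finset.mem_filter.1 hv).2

lemma OnCycle.period_dvd_cyclicity [Fintype V] {v : V} (h : OnCycle G v) :
    period G v ∣ cyclicity G := by
  classical
  exact (period_dvd_componentCyclicity v).trans (Finset.dvd_lcm (by simpa using h))

/-- If `i` lies on a cycle and does not strongly access `j`, then some node of its component has
no path to `j` as long as one of its closed paths. -/
lemma OnCycle.exists_of_not_stronglyAccesses {i j : V} (hi : OnCycle G i)
    (h : ¬ StronglyAccesses G i j) :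
    ∃ i', SameComponent G i i' ∧ ∀ t, HasPath G t i' i' → ¬ HasPath G t i' j := by
  by_contra! hc
  apply h
  set g := period G i with hg
  have hg0 : 0 < g := Nat.pos_of_ne_zero hi.period_ne_zero
  obtain ⟨T, hT⟩ := exists_forall_hasPath_of_period_dvd (G := G) i
  -- Every residue class modulo `g` contains the length of a path to `j`: take `c` steps along a
  -- closed path at `i`, then go to `j` by a path as long as some closed path at the node reached,
  -- so of length divisible by `g`.
  have key : ∀ c, ∃ a, HasPath G a i j ∧ a ≡ c [MOD g] := by
    intro c
    obtain ⟨k, hk, hp⟩ := hi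
    have hcl := hp.mul_left c
    have hck : c ≤ c * k := Nat.le_mul_of_pos_right _ hk
    obtain ⟨r, hr⟩ := Nat.exists_eq_add_of_le hck
    rw [hr] at hcl
    obtain ⟨i', h1, h2⟩ := hasPath_add.1 hcl
    have hs : SameComponent G i i' := ⟨h1.accesses, h2.accesses⟩
    obtain ⟨t, ht, htj⟩ := hc i' hs
    refine ⟨c + t, h1.trans htj, ?_⟩
    have : t ≡ 0 [MOD g] := (Nat.modEq_zero_iff_dvd).2 (period_dvd hs ht)
    simpa using this.add_left c
  choose a ha hac using key
  refine ⟨T + (Finset.range g).sup a, fun t ht => ?_⟩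
  have hle : a (t % g) ≤ (Finset.range g).sup a :=
    Finset.le_sup (f := a) (Finset.mem_range.2 (Nat.mod_lt _ hg0))
  have hd : g ∣ t - a (t % g) := by
    refine (Nat.modEq_iff_dvd' (by omega)).1 ?_
    exact (hac _).trans (Nat.mod_modEq _ _)
  have := (hT (t - a (t % g)) (by omega) hd).trans (ha (t % g))
  rwa [Nat.sub_add_cancel (by omega)] at this

end Paths

/-! ### Max-algebraic matrix powers -/

section Powers

variable {n : ℕ} {A : Matrix (Fin n) (Fin n) ℝ≥0}

lemma le_mul_apply (A B : Matrix (Fin n) (Fin n) ℝ≥0) (i k j : Fin n) :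
    A i k * B k j ≤ mul A B i j :=
  Finset.le_sup (f := fun k => A i k * B k j) (Finset.mem_univ k)

lemma exists_mul_apply (A B : Matrix (Fin n) (Fin n) ℝ≥0) (i j : Fin n) :
    ∃ k, mul A B i j = A i k * B k j := by
  obtain ⟨k, -, hk⟩ := Finset.exists_mem_eq_sup Finset.univ ⟨i, Finset.mem_univ i⟩
    (fun k => A i k * B k j)
  exact ⟨k, hk⟩

lemma le_mulVec (A : Matrix (Fin n) (Fin n) ℝ≥0) (y : Fin n → ℝ≥0) (i k : Fin n) :
    A i k * y k ≤ mulVec A y i :=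
  Finset.le_sup (f := fun k => A i k * y k) (Finset.mem_univ k)

lemma exists_mulVec_apply (A : Matrix (Fin n) (Fin n) ℝ≥0) (y : Fin n → ℝ≥0) (i : Fin n) :
    ∃ k, mulVec A y i = A i k * y k := by
  obtain ⟨k, -, hk⟩ := Finset.exists_mem_eq_sup Finset.univ ⟨i, Finset.mem_univ i⟩
    (fun k => A i k * y k)
  exact ⟨k, hk⟩

lemma pow_zero_self (i : Fin n) : pow A 0 i i = 1 := Matrix.one_apply_eq i

lemma pow_zero_of_ne {i j : Fin n} (h : i ≠ j) : pow A 0 i j = 0 := Matrix.one_apply_ne h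

lemma pow_add_le (s t : ℕ) (i l j : Fin n) : pow A s i l * pow A t l j ≤ pow A (s + t) i j := by
  induction t generalizing j with
  | zero =>
    rcases eq_or_ne l j with rfl | h
    · simp [pow_zero_self]
    · simp [pow_zero_of_ne h]
  | succ t ih =>
    obtain ⟨m, hm⟩ := exists_mul_apply (pow A t) A l j
    calc pow A s i l * pow A (t + 1) l j = pow A s i l * pow A t l m * A m j := by
          rw [pow, hm, mul_assoc]
      _ ≤ pow A (s + t) i m * A m j := by gcongr; exact ih m
      _ ≤ pow A (s + (t + 1)) i j := le_mul_apply _ _ _ _ _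

lemma pow_one (A : Matrix (Fin n) (Fin n) ℝ≥0) (i j : Fin n) : pow A 1 i j = A i j := by
  apply le_antisymm
  · obtain ⟨k, hk⟩ := exists_mul_apply (pow A 0) A i j
    rw [pow, hk]
    rcases eq_or_ne i k with rfl | h
    · simp [pow_zero_self]
    · simp [pow_zero_of_ne h]
  · have := le_mul_apply (pow A 0) A i i j
    rwa [pow_zero_self, one_mul] at this

/-- The weight of the first `t` edges of a sequence of nodes. -/
def seqWeight (A : Matrix (Fin n) (Fin n) ℝ≥0) (q : ℕ → Fin n) (t : ℕ) : ℝ≥0 :=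
  ∏ s ∈ Finset.range t, A (q s) (q (s + 1))

lemma seqWeight_le (q : ℕ → Fin n) (t : ℕ) : seqWeight A q t ≤ pow A t (q 0) (q t) := by
  induction t with
  | zero => simp [seqWeight, pow_zero_self]
  | succ t ih =>
    rw [seqWeight, Finset.prod_range_succ]
    exact (mul_le_mul_left ih _).trans (le_mul_apply _ _ _ _ _)

lemma seqWeight_add (q : ℕ → Fin n) (a b : ℕ) :
    seqWeight A q (a + b) = seqWeight A q a * seqWeight A (fun s => q (a + s)) b := by
  simp [seqWeight, Finset.prod_range_add, add_assoc]

lemma exists_seqWeight_eq {t : ℕ} {i j : Fin n} (h : pow A t i j ≠ 0) :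
    ∃ q : ℕ → Fin n, q 0 = i ∧ q t = j ∧ seqWeight A q t = pow A t i j := by
  induction t generalizing j with
  | zero =>
    obtain rfl : i = j := by
      by_contra hij
      exact h (pow_zero_of_ne hij)
    exact ⟨fun _ => i, rfl, rfl, by simp [seqWeight, pow_zero_self]⟩
  | succ t ih =>
    obtain ⟨m, hm⟩ := exists_mul_apply (pow A t) A i j
    rw [pow, hm] at h
    obtain ⟨q, h0, ht, hq⟩ := ih (left_ne_zero_of_mul h)
    refine ⟨fun s => if s ≤ t then q s else j, by simpa using h0, by simp, ?_⟩
    rw [seqWeight, Finset.prod_range_succ, pow, hm, ← hq, seqWeight]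
    congr 1
    · refine Finset.prod_congr rfl fun s hs => ?_
      have := Finset.mem_range.1 hs
      simp [this.le, Nat.succ_le_of_lt this]
    · simp [ht]

lemma seqWeight_le_mul_mul (q : ℕ → Fin n) {a b t : ℕ} (hab : a ≤ b) (hbt : b ≤ t) :
    seqWeight A q t ≤ pow A a (q 0) (q a) * pow A (b - a) (q a) (q b) *
      pow A (t - b) (q b) (q t) := by
  obtain ⟨c, rfl⟩ := Nat.exists_eq_add_of_le hab
  obtain ⟨d, rfl⟩ := Nat.exists_eq_add_of_le hbt
  rw [seqWeight_add, seqWeight_add, Nat.add_sub_cancel_left, Nat.add_sub_cancel_left]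
  exact mul_le_mul' (mul_le_mul' (seqWeight_le q a) (seqWeight_le (fun s => q (a + s)) c))
    (seqWeight_le (fun s => q (a + c + s)) d)

lemma hasPath_digraph {t : ℕ} {i j : Fin n} : HasPath (digraph A) t i j ↔ pow A t i j ≠ 0 := by
  rw [hasPath_iff_seq]
  constructor
  · rintro ⟨q, rfl, rfl, hq⟩ h
    have := seqWeight_le (A := A) q t
    rw [h, nonpos_iff_eq_zero, seqWeight, Finset.prod_eq_zero_iff] at this
    obtain ⟨s, hs, h0⟩ := this
    exact hq s (Finset.mem_range.1 hs) h0
  · intro h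
    obtain ⟨q, h0, ht, hq⟩ := exists_seqWeight_eq h
    refine ⟨q, h0, ht, fun s hs => ?_⟩
    rw [← hq, seqWeight] at h
    exact Finset.prod_ne_zero_iff.1 h s (Finset.mem_range.2 hs)

lemma pow_mono {A B : Matrix (Fin n) (Fin n) ℝ≥0} (h : ∀ i j, A i j ≤ B i j) (t : ℕ)
    (i j : Fin n) : pow A t i j ≤ pow B t i j := by
  induction t generalizing j with
  | zero => exact le_rfl
  | succ t ih =>
    obtain ⟨k, hk⟩ := exists_mul_apply (pow A t) A i j
    rw [pow, hk]
    exact (mul_le_mul' (ih k) (h k j)).trans (le_mul_apply _ _ _ _ _)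

lemma pow_smul (c : ℝ≥0) (t : ℕ) : pow (c • A) t = c ^ t • pow A t := by
  induction t with
  | zero => simp [pow]
  | succ t ih =>
    refine Matrix.ext fun i j => ?_
    apply le_antisymm
    · obtain ⟨k, hk⟩ := exists_mul_apply (pow (c • A) t) (c • A) i j
      have := le_mul_apply (pow A t) A i k j
      rw [pow, hk, ih]
      simp only [Matrix.smul_apply, smul_eq_mul, pow]
      calc c ^ t * pow A t i k * (c * A k j) = c ^ (t + 1) * (pow A t i k * A k j) := by ring
        _ ≤ _ := by gcongr
    · obtain ⟨k, hk⟩ := exists_mul_apply (pow A t) A i j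
      have := le_mul_apply (pow (c • A) t) (c • A) i k j
      simp only [Matrix.smul_apply, smul_eq_mul, pow, hk]
      refine le_trans (le_of_eq ?_) this
      rw [ih]
      simp only [Matrix.smul_apply, smul_eq_mul]
      ring

/-- Any long enough path repeats a node at two times congruent modulo `N`. -/
lemma exists_repeat {N : ℕ} (hN : 0 < N) (q : ℕ → Fin n) :
    ∃ a b, a < b ∧ b ≤ n * N ∧ a ≡ b [MOD N] ∧ q a = q b := by
  -- Pigeonhole: `n * N + 1` times against `n * N` pairs of a node and a residue.
  have hcard : (Finset.univ : Finset (Fin n × Fin N)).card < (Finset.range (n * N + 1)).card := by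
    simp
  obtain ⟨a, ha, b, hb, hab, he⟩ := Finset.exists_ne_map_eq_of_card_lt_of_maps_to hcard
    (f := fun s => (q s, (⟨s % N, Nat.mod_lt _ hN⟩ : Fin N)))
    (fun _ _ => Finset.mem_coe.2 (Finset.mem_univ _))
  simp only [Prod.mk.injEq, Fin.mk.injEq, Finset.mem_range] at he ha hb
  rcases lt_or_gt_of_ne hab with h | h
  · exact ⟨a, b, h, by omega, he.2, he.1⟩
  · exact ⟨b, a, h, by omega, he.2.symm, he.1.symm⟩

/-- Cutting out closed subpaths, a path is shortened to length less than `n * N` while its length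
modulo `N` is kept; its weight does not decrease if closed paths have weight at most `1`. -/
lemma exists_short_path {N : ℕ} (hN : 0 < N) (t : ℕ) (i k : Fin n) (h : pow A t i k ≠ 0) :
    ∃ t' < n * N, t' ≤ t ∧ t' ≡ t [MOD N] ∧ pow A t' i k ≠ 0 ∧
      ((∀ v m, Accesses (digraph A) v k → pow A m v v ≤ 1) → pow A t i k ≤ pow A t' i k) := by
  induction t using Nat.strong_induction_on with
  | _ t ih =>
    rcases Nat.lt_or_ge t (n * N) with hlt | hge
    · exact ⟨t, hlt, le_rfl, rfl, h, fun _ => le_rfl⟩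
    obtain ⟨q, h0, ht, hq⟩ := exists_seqWeight_eq h
    obtain ⟨a, b, hab, hb, hmod, he⟩ := exists_repeat hN q
    have hle := seqWeight_le_mul_mul (A := A) q hab.le (hb.trans hge)
    rw [hq, h0, ht, ← he] at hle
    have hne := (pos_of_ne_zero h).trans_le hle |>.ne'
    have hne1 := right_ne_zero_of_mul hne
    have hne2 := left_ne_zero_of_mul (left_ne_zero_of_mul hne)
    have hadd := pow_add_le (A := A) a (t - b) i (q a) k
    have hne3 : pow A (a + (t - b)) i k ≠ 0 :=
      ((pos_of_ne_zero (mul_ne_zero hne2 hne1)).trans_le hadd).ne'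
    obtain ⟨t', h1, h2, h3, h4, h5⟩ := ih (a + (t - b)) (by omega) hne3
    refine ⟨t', h1, by omega, h3.trans ?_, h4, fun hA => ?_⟩
    · have := hmod.add_right (t - b)
      rwa [Nat.add_sub_cancel' (hb.trans hge)] at this
    · refine le_trans ?_ (h5 hA)
      refine le_trans (hle.trans ?_) hadd
      gcongr
      exact mul_le_of_le_one_right zero_le (hA _ _ ⟨_, hasPath_digraph.2 hne1⟩)

end Powers

/-! ### Cycle means and critical nodes -/

section CycleMeans

variable {n : ℕ} {A : Matrix (Fin n) (Fin n) ℝ≥0}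

lemma weight_eq_seqWeight {t : ℕ} (q : ℕ → Fin n) :
    weight A (fun s : Fin (t + 1) => q s) = seqWeight A q t := by
  rw [weight, seqWeight, ← Fin.prod_univ_eq_prod_range]
  rfl

lemma exists_path_seq {t : ℕ} (p : Fin (t + 1) → Fin n) :
    ∃ q : ℕ → Fin n, p = fun s : Fin (t + 1) => q s :=
  ⟨fun s => if h : s < t + 1 then p ⟨s, h⟩ else p 0, by funext s; simp [show (s : ℕ) ≤ t by omega]⟩

lemma exists_isCycle_weight_eq {m : ℕ} (hm : 1 ≤ m) {u : Fin n} (h : pow A m u u ≠ 0) :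
    ∃ p : Fin (m + 1) → Fin n, IsCycle (digraph A) p ∧ weight A p = pow A m u u ∧ p 0 = u := by
  obtain ⟨q, h0, hq, hw⟩ := exists_seqWeight_eq h
  refine ⟨fun s => q s, ⟨hm, fun s => ?_, ?_⟩, by rw [weight_eq_seqWeight, hw], h0⟩
  · rw [← hw, seqWeight] at h
    exact Finset.prod_ne_zero_iff.1 h s (Finset.mem_range.2 s.2)
  · simp [h0, hq]

lemma le_mcgm {k : ℕ} (hk : k ≤ n) {p : Fin (k + 1) → Fin n} (hp : IsCycle (digraph A) p) :
    weight A p ^ (1 / (k : ℝ)) ≤ mcgm A := by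
  classical
  have h1 : weight A p ^ (1 / (k : ℝ)) ≤
      (Finset.univ.filter fun p : Fin (k + 1) → Fin n => IsCycle (digraph A) p).sup fun p =>
        weight A p ^ (1 / (k : ℝ)) :=
    Finset.le_sup (f := fun p : Fin (k + 1) → Fin n => weight A p ^ (1 / (k : ℝ)))
      (by simpa using hp)
  refine h1.trans ?_
  unfold mcgm
  convert Finset.le_sup (f := fun k : ℕ =>
    (Finset.univ.filter fun p : Fin (k + 1) → Fin n => IsCycle (digraph A) p).sup fun p =>
      weight A p ^ (1 / (k : ℝ))) (Finset.mem_Icc.2 ⟨hp.1, hk⟩)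

lemma root_eq_iff {k : ℕ} (hk : 1 ≤ k) {x y : ℝ≥0} : x ^ (1 / (k : ℝ)) = y ↔ x = y ^ k := by
  rw [one_div]
  constructor
  · rintro rfl
    exact (NNReal.rpow_inv_natCast_pow x (by omega)).symm
  · rintro rfl
    exact NNReal.pow_rpow_inv_natCast y (by omega)

/-- `mcgm` only ranges over cycles of length at most `n`. A longer closed path splits at a repeated
node into two shorter closed paths, to which induction applies. -/
lemma pow_le_mcgm_pow (u : Fin n) (m : ℕ) : pow A m u u ≤ mcgm A ^ m := by
  induction m using Nat.strong_induction_on generalizing u with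
  | _ m ih =>
    rcases Nat.eq_zero_or_pos m with rfl | hm
    · simp [pow_zero_self]
    rcases eq_or_ne (pow A m u u) 0 with h | h
    · simp [h]
    rcases Nat.lt_or_ge n m with hnm | hmn
    · obtain ⟨q, h0, hq, hw⟩ := exists_seqWeight_eq h
      obtain ⟨a, b, hab, hb, -, he⟩ := exists_repeat one_pos q
      have hle := seqWeight_le_mul_mul (A := A) q hab.le (show b ≤ m by omega)
      rw [hw, h0, hq, ← he] at hle
      calc pow A m u u ≤ pow A a u (q a) * pow A (b - a) (q a) (q a) * pow A (m - b) (q a) u := hle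
        _ = (pow A a u (q a) * pow A (m - b) (q a) u) * pow A (b - a) (q a) (q a) := by ring
        _ ≤ mcgm A ^ (a + (m - b)) * mcgm A ^ (b - a) :=
          mul_le_mul' ((pow_add_le _ _ _ _ _).trans (ih _ (by omega) u)) (ih _ (by omega) _)
        _ = mcgm A ^ m := by rw [← pow_add]; congr 1; omega
    · obtain ⟨p, hp, hw, -⟩ := exists_isCycle_weight_eq hm h
      have h1 := pow_le_pow_left' (le_mcgm hmn hp) m
      rwa [one_div, NNReal.rpow_inv_natCast_pow _ (by omega), hw] at h1

lemma weight_le {t : ℕ} (p : Fin (t + 1) → Fin n) :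
    weight A p ≤ pow A t (p 0) (p (Fin.last t)) := by
  obtain ⟨q, rfl⟩ := exists_path_seq p
  rw [weight_eq_seqWeight]
  exact seqWeight_le q t

lemma exists_pow_eq_mcgm_pow (h : mcgm A ≠ 0) :
    ∃ m u, 1 ≤ m ∧ pow A m u u = mcgm A ^ m := by
  classical
  have h' := h
  rw [mcgm] at h'
  have hne : (Finset.Icc 1 n).Nonempty := by
    rw [Finset.nonempty_iff_ne_empty]
    intro he
    simp [he] at h'
  obtain ⟨k, hk, hk'⟩ := Finset.exists_mem_eq_sup _ hne (fun k : ℕ =>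
    (Finset.univ.filter fun p : Fin (k + 1) → Fin n => IsCycle (digraph A) p).sup fun p =>
      weight A p ^ (1 / (k : ℝ)))
  have h2 : mcgm A = (Finset.univ.filter fun p : Fin (k + 1) → Fin n =>
      IsCycle (digraph A) p).sup fun p => weight A p ^ (1 / (k : ℝ)) := by
    unfold mcgm; convert hk'
  have hne2 : (Finset.univ.filter fun p : Fin (k + 1) → Fin n =>
      IsCycle (digraph A) p).Nonempty := by
    rw [Finset.nonempty_iff_ne_empty]
    intro he
    rw [he] at h2
    exact h (by simpa using h2)
  obtain ⟨p, hp, hp'⟩ := Finset.exists_mem_eq_sup _ hne2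
    (fun p : Fin (k + 1) → Fin n => weight A p ^ (1 / (k : ℝ)))
  have hc : IsCycle (digraph A) p := by simpa using hp
  refine ⟨k, p 0, hc.1, le_antisymm (pow_le_mcgm_pow _ _) ?_⟩
  rw [← (root_eq_iff hc.1).1 (hp'.symm.trans h2.symm)]
  have := weight_le (A := A) p
  rwa [← hc.2.2] at this

lemma mcgm_ne_zero {m : ℕ} (hm : 1 ≤ m) {u : Fin n} (h : pow A m u u ≠ 0) : mcgm A ≠ 0 := by
  intro h0
  have := pow_le_mcgm_pow (A := A) u m
  rw [h0, zero_pow (by omega)] at this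
  exact h (le_antisymm this zero_le)

lemma onCycle_digraph {u : Fin n} : OnCycle (digraph A) u ↔ ∃ m, 1 ≤ m ∧ pow A m u u ≠ 0 := by
  simp only [OnCycle, hasPath_digraph]

/-- The rest of the critical cycle leads back from `b` to `a`; `1 + r` is the length of the cycle.
-/
lemma exists_return_of_criticalDigraph_adj {a b : Fin n} (h : (criticalDigraph A).Adj a b) :
    ∃ r, mcgm A ^ (1 + r) ≤ A a b * pow A r b a := by
  obtain ⟨k, p, hp, hw, s, rfl, rfl⟩ := h
  rw [root_eq_iff hp.1] at hw
  obtain ⟨hk, -, hcl⟩ := hp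
  obtain ⟨q, rfl⟩ := exists_path_seq p
  have hs := s.2
  rw [weight_eq_seqWeight] at hw
  refine ⟨k - (s + 1) + s, ?_⟩
  have h1 := seqWeight_le_mul_mul (A := A) q (Nat.le_succ s) (Nat.succ_le_of_lt s.2)
  simp only [Nat.succ_eq_add_one, Nat.add_sub_cancel_left, pow_one, hw] at h1
  simp only [Fin.val_zero, Fin.val_last] at hcl
  rw [show 1 + (k - (s + 1) + s) = k by omega]
  refine h1.trans ?_
  rw [← hcl, mul_comm (pow A s _ _), mul_assoc]
  simp only [Fin.val_castSucc, Fin.val_succ]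
  gcongr
  rw [mul_comm]
  exact pow_add_le _ _ _ _ _

lemma exists_return_of_hasPath_criticalDigraph {m : ℕ} {a b : Fin n}
    (h : HasPath (criticalDigraph A) m a b) :
    ∃ r, mcgm A ^ (m + r) ≤ pow A m a b * pow A r b a := by
  induction m generalizing b with
  | zero =>
    obtain rfl := hasPath_zero.1 h
    exact ⟨0, by simp [pow_zero_self]⟩
  | succ m ih =>
    obtain ⟨l, hl, hlb⟩ := hasPath_succ.1 h
    obtain ⟨r, hr⟩ := ih hl
    obtain ⟨r', hr'⟩ := exists_return_of_criticalDigraph_adj hlb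
    refine ⟨r' + r, ?_⟩
    calc mcgm A ^ (m + 1 + (r' + r)) = mcgm A ^ (m + r) * mcgm A ^ (1 + r') := by
          rw [← pow_add]; congr 1; omega
      _ ≤ (pow A m a l * pow A r l a) * (A l b * pow A r' b l) := mul_le_mul' hr hr'
      _ = (pow A m a l * A l b) * (pow A r' b l * pow A r l a) := by ring
      _ ≤ pow A (m + 1) a b * pow A (r' + r) b a :=
        mul_le_mul' (le_mul_apply _ _ _ _ _) (pow_add_le _ _ _ _ _)

/-- A closed path may mix edges of different critical cycles. With the concatenated return path it
has total weight at least `mcgm A ^ (m + r)`, and neither factor can exceed its own share, so both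
are tight. -/
lemma pow_eq_of_hasPath_criticalDigraph (h0 : mcgm A ≠ 0) {m : ℕ} {v : Fin n}
    (h : HasPath (criticalDigraph A) m v v) : pow A m v v = mcgm A ^ m := by
  refine le_antisymm (pow_le_mcgm_pow _ _) ?_
  obtain ⟨r, hr⟩ := exists_return_of_hasPath_criticalDigraph h
  have h2 : mcgm A ^ m * mcgm A ^ r ≤ pow A m v v * mcgm A ^ r := by
    rw [← pow_add]
    exact hr.trans (mul_le_mul' le_rfl (pow_le_mcgm_pow _ _))
  exact le_of_mul_le_mul_right h2 (pos_of_ne_zero (pow_ne_zero _ h0))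

lemma hasPath_criticalDigraph {m : ℕ} (hm : 1 ≤ m) {v : Fin n} (h0 : mcgm A ≠ 0)
    (h : pow A m v v = mcgm A ^ m) : HasPath (criticalDigraph A) m v v := by
  obtain ⟨p, hp, hw, hv⟩ := exists_isCycle_weight_eq hm (h ▸ pow_ne_zero m h0)
  refine ⟨p, fun s => ⟨m, p, hp, (root_eq_iff hm).2 (hw.trans h), s, rfl, rfl⟩, hv, ?_⟩
  rw [← hp.2.2, hv]

/-! ### Components -/

lemma componentMatrix_congr {i j : Fin n} (h : SameComponent (digraph A) i j) :
    componentMatrix A i = componentMatrix A j := by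
  classical
  have key : ∀ k, SameComponent (digraph A) i k ↔ SameComponent (digraph A) j k :=
    fun k => ⟨fun h' => h.symm.trans h', fun h' => h.trans h'⟩
  refine Matrix.ext fun k l => ?_
  simp only [componentMatrix, Matrix.of_apply]
  exact if_congr (and_congr (key k) (key l)) rfl rfl

lemma nodeMcgm_congr {i j : Fin n} (h : SameComponent (digraph A) i j) :
    nodeMcgm A i = nodeMcgm A j := by
  rw [nodeMcgm, nodeMcgm, componentMatrix_congr h]

lemma componentMatrix_le (i k l : Fin n) : componentMatrix A i k l ≤ A k l := by
  simp only [componentMatrix, Matrix.of_apply]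
  split_ifs <;> simp

/-- A closed path never leaves the component of its nodes. -/
lemma pow_componentMatrix {i u : Fin n} (h : SameComponent (digraph A) i u) (m : ℕ) :
    pow (componentMatrix A i) m u u = pow A m u u := by
  refine le_antisymm (pow_mono (componentMatrix_le i) m u u) ?_
  rcases eq_or_ne (pow A m u u) 0 with h0 | h0
  · simp [h0]
  obtain ⟨q, hq0, hqm, hw⟩ := exists_seqWeight_eq h0
  have hsc : ∀ s ≤ m, SameComponent (digraph A) i (q s) := by
    intro s hs
    have h1 := seqWeight_le_mul_mul (A := A) q hs le_rfl
    rw [hw] at h1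
    have h2 := left_ne_zero_of_mul ((pos_of_ne_zero h0).trans_le h1).ne'
    rw [hq0, hqm] at h2
    exact h.trans ⟨⟨s, hasPath_digraph.2 (left_ne_zero_of_mul h2)⟩,
      ⟨_, hasPath_digraph.2 (right_ne_zero_of_mul h2)⟩⟩
  have := seqWeight_le (A := componentMatrix A i) q m
  rw [hq0, hqm] at this
  refine le_trans (le_of_eq ?_) this
  rw [← hw]
  refine Finset.prod_congr rfl fun s hs => ?_
  have hs' := Finset.mem_range.1 hs
  simp only [componentMatrix, Matrix.of_apply]
  rw [if_pos ⟨hsc s hs'.le, hsc _ hs'⟩]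

lemma pow_le_nodeMcgm_pow (v : Fin n) (m : ℕ) : pow A m v v ≤ nodeMcgm A v ^ m := by
  rw [← pow_componentMatrix (.refl v)]
  exact pow_le_mcgm_pow v m

lemma sameComponent_of_pow_componentMatrix_ne_zero {i u v : Fin n} {m : ℕ} (hm : 1 ≤ m)
    (h : pow (componentMatrix A i) m v u ≠ 0) : SameComponent (digraph A) i u := by
  obtain ⟨m, rfl⟩ := Nat.exists_eq_add_of_le' hm
  obtain ⟨k, hk⟩ := exists_mul_apply (pow (componentMatrix A i) m) (componentMatrix A i) v u
  rw [pow, hk] at h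
  have := right_ne_zero_of_mul h
  by_contra hc
  exact this (by simp [componentMatrix, hc])

lemma nodeMcgm_ne_zero {v : Fin n} (h : OnCycle (digraph A) v) : nodeMcgm A v ≠ 0 := by
  obtain ⟨m, hm, hp⟩ := onCycle_digraph.1 h
  rw [← pow_componentMatrix (.refl v)] at hp
  exact mcgm_ne_zero hm hp

lemma exists_critical {v : Fin n} (h : nodeMcgm A v ≠ 0) :
    ∃ c m, SameComponent (digraph A) v c ∧ 1 ≤ m ∧ pow A m c c = nodeMcgm A v ^ m := by
  obtain ⟨m, u, hm, hu⟩ := exists_pow_eq_mcgm_pow h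
  have hs : SameComponent (digraph A) v u :=
    sameComponent_of_pow_componentMatrix_ne_zero hm (hu ▸ pow_ne_zero m h)
  exact ⟨u, m, hs, hm, by rw [← pow_componentMatrix hs]; exact hu⟩

lemma onCycle_of_nodeMcgm_ne_zero {v : Fin n} (h : nodeMcgm A v ≠ 0) :
    OnCycle (digraph A) v := by
  obtain ⟨c, m, hc, hm, hp⟩ := exists_critical h
  exact hc.symm.onCycle (onCycle_digraph.2 ⟨m, hm, hp ▸ pow_ne_zero m h⟩)

lemma jointCyclicity_pos (A : Matrix (Fin n) (Fin n) ℝ≥0) : 0 < jointCyclicity A := by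
  rw [Nat.pos_iff_ne_zero, jointCyclicity, Finset.lcm_ne_zero_iff]
  exact fun _ _ => cyclicity_ne_zero

/-- The choice of γ enters here: it is a multiple of the period of `v` in the critical digraph of
its component, so its large multiples are lengths of critical closed paths at `v`. -/
lemma exists_forall_pow_eq_nodeMcgm_pow {v : Fin n} {m : ℕ} (hm : 1 ≤ m)
    (h : pow A m v v = nodeMcgm A v ^ m) :
    ∃ T, ∀ t, T ≤ t → jointCyclicity A ∣ t → pow A t v v = nodeMcgm A v ^ t := by
  rcases eq_or_ne (nodeMcgm A v) 0 with h0 | h0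
  · refine ⟨1, fun t ht _ => le_antisymm (pow_le_nodeMcgm_pow _ _) ?_⟩
    rw [h0, zero_pow (by omega)]
    exact zero_le
  rw [← pow_componentMatrix (.refl v)] at h
  have hp := hasPath_criticalDigraph hm h0 h
  have hon : OnCycle (criticalDigraph (componentMatrix A v)) v := ⟨m, hm, hp⟩
  obtain ⟨T, hT⟩ := exists_forall_hasPath_of_period_dvd
    (G := criticalDigraph (componentMatrix A v)) v
  refine ⟨T, fun t ht hd => ?_⟩
  have hdvd : cyclicity (criticalDigraph (componentMatrix A v)) ∣ jointCyclicity A :=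
    Finset.dvd_lcm (f := fun i => cyclicity (criticalDigraph (componentMatrix A i)))
      (Finset.mem_univ v)
  rw [← pow_componentMatrix (.refl v)]
  exact pow_eq_of_hasPath_criticalDigraph h0
    (hT t ht ((hon.period_dvd_cyclicity.trans hdvd).trans hd))

end CycleMeans

/-! ### Ultimate periodicity of normalized orbits -/

section Periodicity

variable {n : ℕ} {A : Matrix (Fin n) (Fin n) ℝ≥0}

lemma exists_pos_le_of_ne_zero {ι : Type*} [Finite ι] (f : ι → ℝ≥0) :
    ∃ c, 0 < c ∧ ∀ x, f x ≠ 0 → c ≤ f x := by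
  rcases isEmpty_or_nonempty {x // f x ≠ 0} with h | h
  · exact ⟨1, one_pos, fun x hx => (h.false ⟨x, hx⟩).elim⟩
  · obtain ⟨x, hx⟩ := Finite.exists_min (fun x : {x // f x ≠ 0} => f x)
    exact ⟨f x, pos_of_ne_zero x.2, fun z hz => hx ⟨z, hz⟩⟩

lemma exists_lt_one_of_forall_lt_one {ι : Type*} [Finite ι] (f : ι → ℝ≥0) :
    ∃ q < 1, ∀ x, f x < 1 → f x ≤ q := by
  rcases isEmpty_or_nonempty {x // f x < 1} with h | h
  · exact ⟨0, one_pos, fun x hx => (h.false ⟨x, hx⟩).elim⟩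
  · obtain ⟨x, hx⟩ := Finite.exists_max (fun x : {x // f x < 1} => f x)
    exact ⟨f x, x.2, fun z hz => hx ⟨z, hz⟩⟩

/-- If closed paths through nodes of `C` of all large lengths divisible by `N` have weight `1`, and
no closed path has weight above `1`, then long paths through `C` are at least as heavy as all paths
through `C` of lengths in the same class modulo `N`. -/
lemma exists_forall_mul_le {y : Fin n → ℝ≥0} {N : ℕ} (hN : 0 < N) {C : Set (Fin n)}
    (hA : ∀ v k m, y k ≠ 0 → Accesses (digraph A) v k → pow A m v v ≤ 1)
    (hC : ∀ v ∈ C, ∃ T, ∀ t, T ≤ t → N ∣ t → pow A t v v = 1) :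
    ∃ T c, 0 < c ∧ ∀ i v k a b s, v ∈ C → y k ≠ 0 → T ≤ s → s ≡ a + b [MOD N] →
      pow A a i v ≠ 0 → pow A b v k ≠ 0 →
      pow A a i v * pow A b v k ≤ pow A s i k ∧ c ≤ pow A s i k * y k := by
  classical
  choose! T hT using hC
  -- After shortening, only finitely many products of two pieces can occur; `c` bounds the nonzero
  -- ones from below.
  obtain ⟨c, hc, hcle⟩ := exists_pos_le_of_ne_zero
    (fun x : Fin (n * N) × Fin (n * N) × Fin n × Fin n × Fin n =>
      pow A x.1 x.2.2.1 x.2.2.2.1 * pow A x.2.1 x.2.2.2.1 x.2.2.2.2 * y x.2.2.2.2)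
  -- Both pieces shrink below `n * N`; the remaining length, a multiple of `N` beyond `T v`, is
  -- filled by a closed path of weight `1` at `v`.
  refine ⟨2 * (n * N) + Finset.univ.sup T, c, hc, fun i v k a b s hv hk hs hmod ha hb => ?_⟩
  have hvk : Accesses (digraph A) v k := ⟨b, hasPath_digraph.2 hb⟩
  obtain ⟨a', ha1, -, ha2, ha3, ha4⟩ := exists_short_path hN a i v ha
  obtain ⟨b', hb1, -, hb2, hb3, hb4⟩ := exists_short_path hN b v k hb
  have ha5 := ha4 fun u m hu => hA u k m hk (hu.trans hvk)
  have hb5 := hb4 fun u m hu => hA u k m hk hu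
  have hTv : T v ≤ Finset.univ.sup T := Finset.le_sup (Finset.mem_univ v)
  have hdvd : N ∣ s - (a' + b') :=
    (Nat.modEq_iff_dvd' (by omega)).1 ((ha2.add hb2).trans hmod.symm)
  have hone := hT v hv (s - (a' + b')) (by omega) hdvd
  have hle : pow A a' i v * pow A b' v k ≤ pow A s i k := by
    have h1 := pow_add_le (A := A) (a' + (s - (a' + b'))) b' i v k
    rw [show a' + (s - (a' + b')) + b' = s by omega] at h1
    have h2 := pow_add_le (A := A) a' (s - (a' + b')) i v v
    rw [hone, mul_one] at h2
    exact (mul_le_mul' h2 le_rfl).trans h1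
  exact ⟨(mul_le_mul' ha5 hb5).trans hle,
    (hcle (⟨a', ha1⟩, ⟨b', hb1⟩, i, v, k) (mul_ne_zero (mul_ne_zero ha3 hb3) hk)).trans
      (mul_le_mul' hle le_rfl)⟩

/-- If all closed paths have weight less than `1`, the entries of the powers tend to zero. -/
lemma exists_forall_pow_lt {S : Set (Fin n)}
    (hA : ∀ k ∈ S, ∀ v m, 1 ≤ m → Accesses (digraph A) v k → pow A m v v < 1)
    {ε : ℝ≥0} (hε : 0 < ε) : ∃ T, ∀ t, T ≤ t → ∀ i, ∀ k ∈ S, pow A t i k < ε := by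
  -- `q` bounds those diagonal entries of the powers up to `n` that lie below `1`. Each cut removes
  -- at most `n` edges and yields a factor at most `q`, whence the exponent `t / n`.
  obtain ⟨q, hq1, hq⟩ := exists_lt_one_of_forall_lt_one
    (fun x : Fin (n + 1) × Fin n => pow A x.1 x.2 x.2)
  obtain ⟨D, hD⟩ := (Set.finite_range
    (fun x : Fin n × Fin n × Fin n => pow A x.1 x.2.1 x.2.2)).bddAbove
  have key : ∀ t i k, k ∈ S → pow A t i k ≤ D * q ^ (t / n) := by
    intro t
    induction t using Nat.strong_induction_on with
    | _ t ih =>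
      intro i k hk
      rcases Nat.lt_or_ge t n with hlt | hge
      · rw [Nat.div_eq_of_lt hlt, pow_zero, mul_one]
        exact hD ⟨(⟨t, hlt⟩, i, k), rfl⟩
      rcases eq_or_ne (pow A t i k) 0 with h | h
      · simp [h]
      obtain ⟨p, h0, ht, hw⟩ := exists_seqWeight_eq h
      obtain ⟨a, b, hab, hb, -, he⟩ := exists_repeat one_pos p
      rw [mul_one] at hb
      have hle := seqWeight_le_mul_mul (A := A) p hab.le (hb.trans hge)
      rw [hw, h0, ht, ← he] at hle
      have hacc : Accesses (digraph A) (p a) k :=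
        ⟨_, hasPath_digraph.2 (right_ne_zero_of_mul ((pos_of_ne_zero h).trans_le hle).ne')⟩
      have hcut : pow A (b - a) (p a) (p a) ≤ q :=
        hq (⟨b - a, by omega⟩, p a) (hA k hk (p a) (b - a) (by omega) hacc)
      have hn : 0 < n := i.pos
      have hdiv : t / n ≤ (a + (t - b)) / n + 1 := by
        rw [← Nat.add_div_right _ hn]
        exact Nat.div_le_div_right (by omega)
      calc pow A t i k ≤ _ := hle
        _ = (pow A a i (p a) * pow A (t - b) (p a) k) * pow A (b - a) (p a) (p a) := by ring
        _ ≤ (D * q ^ ((a + (t - b)) / n)) * q :=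
          mul_le_mul' ((pow_add_le _ _ _ _ _).trans (ih _ (by omega) i k hk)) hcut
        _ = D * q ^ ((a + (t - b)) / n + 1) := by rw [pow_succ, mul_assoc]
        _ ≤ D * q ^ (t / n) := mul_le_mul' le_rfl (pow_le_pow_of_le_one zero_le hq1.le hdiv)
  have hlim : Filter.Tendsto (fun s : ℕ => D * q ^ s) Filter.atTop (nhds 0) := by
    simpa using (NNReal.tendsto_pow_atTop_nhds_zero_of_lt_one hq1).const_mul D
  obtain ⟨s, hs⟩ := Filter.eventually_atTop.1 (hlim.eventually (gt_mem_nhds hε))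
  refine ⟨n * s, fun t ht i k hk => (key t i k hk).trans_lt (hs _ ?_)⟩
  exact (Nat.le_div_iff_mul_le i.pos).2 (by rwa [mul_comm])

open Classical in
/-- The part of `A` on the complement of a set of nodes. -/
noncomputable def avoiding (A : Matrix (Fin n) (Fin n) ℝ≥0) (C : Set (Fin n)) :
    Matrix (Fin n) (Fin n) ℝ≥0 :=
  Matrix.of fun a b => if a ∈ C ∨ b ∈ C then 0 else A a b

lemma avoiding_le (C : Set (Fin n)) (a b : Fin n) : avoiding A C a b ≤ A a b := by
  simp only [avoiding, Matrix.of_apply]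
  split_ifs <;> simp

lemma Accesses.of_avoiding {C : Set (Fin n)} {a b : Fin n}
    (h : Accesses (digraph (avoiding A C)) a b) : Accesses (digraph A) a b := by
  obtain ⟨t, ht⟩ := h
  have := hasPath_digraph.1 ht
  exact ⟨t, hasPath_digraph.2 ((pos_of_ne_zero this).trans_le (pow_mono (avoiding_le C) _ _ _)).ne'⟩

lemma pow_avoiding_of_mem {C : Set (Fin n)} {v : Fin n} (hv : v ∈ C) {m : ℕ} (hm : 1 ≤ m)
    (u : Fin n) : pow (avoiding A C) m u v = 0 := by
  obtain ⟨m, rfl⟩ := Nat.exists_eq_add_of_le' hm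
  obtain ⟨k, hk⟩ := exists_mul_apply (pow (avoiding A C) m) (avoiding A C) u v
  rw [pow, hk]
  simp [avoiding, hv]

/-- Criterion for the ultimate periodicity of an orbit, with growth rate `1`. -/
theorem exists_forall_mulVec_pow_add_eq {y : Fin n → ℝ≥0} {N : ℕ} (hN : 0 < N) {C : Set (Fin n)}
    (hA : ∀ v k m, y k ≠ 0 → Accesses (digraph A) v k → pow A m v v ≤ 1)
    (hC : ∀ v ∈ C, ∃ T, ∀ t, T ≤ t → N ∣ t → pow A t v v = 1)
    (hC' : ∀ v k m, y k ≠ 0 → Accesses (digraph A) v k → 1 ≤ m → pow A m v v = 1 → v ∈ C)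
    (hpath : ∃ T, ∀ t, T ≤ t → ∀ i k, y k ≠ 0 → pow A t i k ≠ 0 →
      ∃ a b v k', v ∈ C ∧ a + b = t ∧ y k' ≠ 0 ∧ pow A a i v ≠ 0 ∧ pow A b v k' ≠ 0) :
    ∃ T, ∀ t, T ≤ t → mulVec (pow A (t + N)) y = mulVec (pow A t) y := by
  obtain ⟨T₁, c, hc, hT₁⟩ := exists_forall_mul_le hN hA hC
  obtain ⟨T₂, hT₂⟩ := hpath
  obtain ⟨Y, hY⟩ := (Set.finite_range y).bddAbove
  have hY' : ∀ k, y k ≤ Y + 1 := fun k => (hY ⟨k, rfl⟩).trans (by simp)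
  -- By `hC'`, closed paths that avoid `C` and access the support of `y` weigh strictly less than
  -- `1`.
  obtain ⟨T₃, hT₃⟩ := exists_forall_pow_lt (A := avoiding A C) (S := {k | y k ≠ 0})
    (fun k hk v m hm hv => by
      by_cases hvC : v ∈ C
      · rw [pow_avoiding_of_mem hvC hm]
        exact one_pos
      · refine (pow_mono (avoiding_le C) m v v).trans_lt
          (lt_of_le_of_ne (hA v k m hk hv.of_avoiding) fun h => hvC ?_)
        exact hC' v k m hk hv.of_avoiding hm h) (ε := c / (Y + 1)) (by positivity)
  have key : ∀ t, max T₁ (max T₂ T₃) ≤ t → ∀ i, mulVec (pow A t) y i = 0 ∨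
      ∃ a b v k, v ∈ C ∧ y k ≠ 0 ∧ a + b = t ∧ pow A a i v ≠ 0 ∧ pow A b v k ≠ 0 ∧
        mulVec (pow A t) y i = pow A a i v * pow A b v k * y k := by
    intro t ht i
    simp only [max_le_iff] at ht
    obtain ⟨k, hk⟩ := exists_mulVec_apply (pow A t) y i
    rcases eq_or_ne (mulVec (pow A t) y i) 0 with h0 | h0
    · exact .inl h0
    refine .inr ?_
    rw [hk] at h0
    have hyk := right_ne_zero_of_mul h0
    have hp := left_ne_zero_of_mul h0
    obtain ⟨q, hq0, hqt, hw⟩ := exists_seqWeight_eq hp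
    by_cases hq : ∃ s ≤ t, q s ∈ C
    · obtain ⟨s, hs, hsC⟩ := hq
      have hle := seqWeight_le_mul_mul (A := A) q (Nat.zero_le s) hs
      rw [hw, hq0, hqt, pow_zero_self, one_mul, Nat.sub_zero] at hle
      have heq : pow A t i k = pow A s i (q s) * pow A (t - s) (q s) k := by
        refine le_antisymm hle ?_
        have := pow_add_le (A := A) s (t - s) i (q s) k
        rwa [Nat.add_sub_cancel' hs] at this
      rw [heq] at hp
      exact ⟨s, t - s, q s, k, hsC, hyk, Nat.add_sub_cancel' hs, left_ne_zero_of_mul hp,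
        right_ne_zero_of_mul hp, by rw [hk, heq]⟩
    -- A path missing `C` contributes less than `c`, whereas `hpath` supplies one of the same length
    -- through `C` contributing at least `c`; so it cannot attain the maximum.
    · push Not at hq
      exfalso
      have h1 : pow A t i k ≤ pow (avoiding A C) t i k := by
        have := seqWeight_le (A := avoiding A C) q t
        rw [hq0, hqt] at this
        rw [← hw]
        refine le_trans (le_of_eq ?_) this
        refine Finset.prod_congr rfl fun s hs => ?_
        have hs' := Finset.mem_range.1 hs
        simp [avoiding, hq s hs'.le, hq (s + 1) hs']
      have h2 := h1.trans_lt (hT₃ t ht.2.2 i k hyk)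
      have h3 : pow A t i k * y k < c :=
        calc pow A t i k * y k ≤ pow A t i k * (Y + 1) := mul_le_mul' le_rfl (hY' k)
          _ < c := (lt_div_iff₀ (by positivity)).1 h2
      obtain ⟨a, b, v, k', hv, hab, hk', ha, hb⟩ := hT₂ t ht.2.1 i k hyk hp
      have h4 := (hT₁ i v k' a b t hv hk' ht.1 (by rw [hab]) ha hb).2
      have h5 := le_mulVec (pow A t) y i k'
      rw [hk] at h5
      exact absurd (h4.trans h5) (not_le.2 h3)
  -- The inequality holds for congruent large lengths in either order, hence is an equality between
  -- `t` and `t + N`.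
  have mono : ∀ t s, max T₁ (max T₂ T₃) ≤ t → max T₁ (max T₂ T₃) ≤ s → s ≡ t [MOD N] → ∀ i,
      mulVec (pow A t) y i ≤ mulVec (pow A s) y i := by
    intro t s ht hs hmod i
    rcases key t ht i with h | ⟨a, b, v, k, hv, hk, rfl, ha, hb, h⟩
    · rw [h]
      exact zero_le
    · rw [h]
      exact (mul_le_mul' (hT₁ i v k a b s hv hk ((le_max_left _ _).trans hs) hmod ha hb).1
        le_rfl).trans (le_mulVec _ _ _ _)
  refine ⟨max T₁ (max T₂ T₃), fun t ht => funext fun i => le_antisymm ?_ ?_⟩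
  · exact mono _ _ (by omega) ht (by simp [Nat.ModEq]) i
  · exact mono _ _ ht (by omega) (by simp [Nat.ModEq]) i

end Periodicity

/-! ### Sufficiency of the accessibility conditions -/

section Sufficiency

variable {n : ℕ} {A : Matrix (Fin n) (Fin n) ℝ≥0}

/-- The bound `s ≤ n` does not depend on the path, which lets the later rerouting thresholds depend
on `l` alone. -/
lemma exists_onCycle_of_pow_ne_zero {t : ℕ} (ht : n ≤ t) {i k : Fin n} (h : pow A t i k ≠ 0) :
    ∃ s l, s ≤ n ∧ OnCycle (digraph A) l ∧ pow A s i l ≠ 0 ∧ pow A (t - s) l k ≠ 0 := by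
  obtain ⟨q, h0, hqt, hw⟩ := exists_seqWeight_eq h
  obtain ⟨a, b, hab, hb, -, he⟩ := exists_repeat one_pos q
  rw [mul_one] at hb
  have hle := seqWeight_le_mul_mul (A := A) q hab.le (hb.trans ht)
  rw [hw, h0, hqt, ← he] at hle
  have hne := ((pos_of_ne_zero h).trans_le hle).ne'
  have h1 := left_ne_zero_of_mul (left_ne_zero_of_mul hne)
  have h2 := right_ne_zero_of_mul (left_ne_zero_of_mul hne)
  have h3 := right_ne_zero_of_mul hne
  refine ⟨a, q a, by omega, onCycle_digraph.2 ⟨b - a, by omega, h2⟩, h1, ?_⟩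
  have := pow_add_le (A := A) (b - a) (t - b) (q a) (q a) k
  rw [show b - a + (t - b) = t - a by omega] at this
  exact ((pos_of_ne_zero (mul_ne_zero h2 h3)).trans_le this).ne'

lemma smul_mulVec (c : ℝ≥0) (M : Matrix (Fin n) (Fin n) ℝ≥0) (y : Fin n → ℝ≥0) :
    mulVec (c • M) y = c • mulVec M y := by
  funext i
  apply le_antisymm
  · obtain ⟨k, hk⟩ := exists_mulVec_apply (c • M) y i
    rw [hk, Matrix.smul_apply, smul_eq_mul, Pi.smul_apply, smul_eq_mul, mul_assoc]
    exact mul_le_mul' le_rfl (le_mulVec _ _ _ _)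
  · obtain ⟨k, hk⟩ := exists_mulVec_apply M y i
    have := le_mulVec (c • M) y i k
    rwa [Matrix.smul_apply, smul_eq_mul, mul_assoc, ← hk] at this

lemma digraph_smul {c : ℝ≥0} (hc : c ≠ 0) : digraph (c • A) = digraph A := by
  ext i j
  simp [digraph, hc]

/-- A long path through a node on a cycle can be replaced by a path of the same length through any
other node of the same component. -/
lemma exists_path_through_of_sameComponent {l c : Fin n} (hl : OnCycle (digraph A) l)
    (hc : SameComponent (digraph A) l c) :
    ∃ T, ∀ t, T ≤ t → ∀ i k s, s ≤ t → HasPath (digraph A) s i l →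
      HasPath (digraph A) (t - s) l k →
      ∃ a b, a + b = t ∧ HasPath (digraph A) a i c ∧ HasPath (digraph A) b c k := by
  obtain ⟨m, hm, hp⟩ := hl
  obtain ⟨⟨d, hd⟩, e, he⟩ := hc
  -- This is the length of a closed path at `l` that visits `c` and then runs round the given cycle,
  -- which makes it positive. Shortening both pieces modulo it leaves a multiple to be filled with
  -- copies; the `+ 1` in the threshold forces at least one copy.
  have hN : 0 < d + e + m := by omega
  refine ⟨2 * (n * (d + e + m)) + 1, fun t ht i k s hs his hlk => ?_⟩
  obtain ⟨s₁, h1, -, h2, h3, -⟩ := exists_short_path hN s i l (hasPath_digraph.1 his)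
  obtain ⟨s₂, h4, -, h5, h6, -⟩ := exists_short_path hN (t - s) l k (hasPath_digraph.1 hlk)
  have hmod := h2.add h5
  rw [Nat.add_sub_cancel' hs] at hmod
  obtain ⟨q, hq⟩ := (Nat.modEq_iff_dvd' (by omega)).1 hmod
  obtain ⟨q, rfl⟩ : ∃ q', q = q' + 1 := by
    refine Nat.exists_eq_succ_of_ne_zero ?_
    rintro rfl
    omega
  have hcl := ((hd.trans he).trans hp).mul_left q
  rw [mul_comm, add_mul, one_mul, add_comm] at hq
  refine ⟨s₁ + d, _, ?_, (hasPath_digraph.2 h3).trans hd,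
    ((he.trans hp).trans hcl).trans (hasPath_digraph.2 h6)⟩
  omega

/-- The prefix up to `l` is kept and the rest discarded; strong access provides a middle piece of
exactly the missing length. -/
lemma exists_path_through_of_stronglyAccesses {l c k' : Fin n}
    (hl : StronglyAccesses (digraph A) l c) (hc : Accesses (digraph A) c k') :
    ∃ T, ∀ t, T ≤ t → ∀ i s, s ≤ n → HasPath (digraph A) s i l →
      ∃ a b, a + b = t ∧ HasPath (digraph A) a i c ∧ HasPath (digraph A) b c k' := by
  obtain ⟨T, hT⟩ := hl
  obtain ⟨e, he⟩ := hc
  exact ⟨n + T + e, fun t ht i s hs his =>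
    ⟨s + (t - e - s), e, by omega, his.trans (hT _ (by omega)), he⟩⟩

theorem ultimatelyLinearPeriodic_of_conditions
    (h : ∀ i j : Fin n, OnCycle (digraph A) i → OnCycle (digraph A) j →
        (Accesses (digraph A) i j → nodeMcgm A i ≤ nodeMcgm A j) ∧
        (¬ StronglyAccesses (digraph A) j i ∧ ¬ StronglyAccesses (digraph A) i j →
          nodeMcgm A i = nodeMcgm A j)) (y : Fin n → ℝ≥0) :
    UltimatelyLinearPeriodic A y := by
  classical
  set R : Finset (Fin n) := {v | ∃ k, y k ≠ 0 ∧ Accesses (digraph A) v k} with hR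
  have hmemR : ∀ v, v ∈ R ↔ ∃ k, y k ≠ 0 ∧ Accesses (digraph A) v k := fun v => by simp [hR]
  set μ := R.sup (nodeMcgm A) with hμ
  have hle : ∀ v ∈ R, nodeMcgm A v ≤ μ := fun v hv => Finset.le_sup hv
  -- If μ = 0, no node on a cycle accesses the support of `y`, so the orbit vanishes from time `n`
  -- on.
  rcases eq_or_ne μ 0 with h0 | h0
  · have hz : ∀ t, n ≤ t → mulVec (pow A t) y = 0 := by
      intro t ht
      funext i
      obtain ⟨k, hk⟩ := exists_mulVec_apply (pow A t) y i
      by_contra hne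
      rw [hk] at hne
      obtain ⟨s, l, -, hl, -, hlk⟩ :=
        exists_onCycle_of_pow_ne_zero ht (left_ne_zero_of_mul hne)
      have := hle l ((hmemR l).2 ⟨k, right_ne_zero_of_mul hne, _, hasPath_digraph.2 hlk⟩)
      rw [h0] at this
      exact nodeMcgm_ne_zero hl (le_antisymm this zero_le)
    exact ⟨0, n, fun t ht => by rw [hz t ht, hz _ (by omega), smul_zero]⟩
  obtain ⟨j, hjR, hj⟩ : ∃ j ∈ R, μ = nodeMcgm A j := by
    refine Finset.exists_mem_eq_sup R ?_ _
    rw [Finset.nonempty_iff_ne_empty]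
    intro he
    exact h0 (by simp [hμ, he])
  have hjC : OnCycle (digraph A) j := onCycle_of_nodeMcgm_ne_zero (hj ▸ h0)
  have hpow : ∀ t i k, pow (μ⁻¹ • A) t i k = (μ ^ t)⁻¹ * pow A t i k := by
    intro t i k
    rw [pow_smul, inv_pow]
    rfl
  have hμt : ∀ t, μ ^ t ≠ 0 := fun t => pow_ne_zero t h0
  have hone : ∀ t i k, pow (μ⁻¹ • A) t i k = 1 ↔ pow A t i k = μ ^ t := by
    intro t i k
    rw [hpow, inv_mul_eq_one₀ (hμt t), eq_comm]
  have hacc : ∀ v, nodeMcgm A v = μ → ∃ c m, SameComponent (digraph A) v c ∧ 1 ≤ m ∧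
      pow A m c c = μ ^ m := by
    rintro v hv
    have := exists_critical (v := v) (hv ▸ h0)
    rwa [hv] at this
  have hRmono : ∀ u v, v ∈ R → Accesses (digraph A) u v → u ∈ R := by
    intro u v hv huv
    obtain ⟨k, hk, hvk⟩ := (hmemR v).1 hv
    exact (hmemR u).2 ⟨k, hk, huv.trans hvk⟩
  have hdig : digraph (μ⁻¹ • A) = digraph A := digraph_smul (inv_ne_zero h0)
  set C : Set (Fin n) := {v | v ∈ R ∧ ∃ m, 1 ≤ m ∧ pow A m v v = μ ^ m} with hC
  obtain ⟨c, m, hjc, hm, hcm⟩ := hacc j hj.symm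
  obtain ⟨kc, hkc, hckc⟩ := (hmemR c).1 (hRmono c j hjR hjc.2)
  have through : ∀ l, OnCycle (digraph A) l → l ∈ R → ∃ T, ∀ t, T ≤ t → ∀ i k s, y k ≠ 0 →
      s ≤ n → s ≤ t → HasPath (digraph A) s i l → HasPath (digraph A) (t - s) l k →
      ∃ a b v k', v ∈ C ∧ a + b = t ∧ y k' ≠ 0 ∧ HasPath (digraph A) a i v ∧
        HasPath (digraph A) b v k' := by
    intro l hl hlR
    by_cases hlμ : nodeMcgm A l = μ
    · obtain ⟨d, m', hld, hm', hdm⟩ := hacc l hlμ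
      obtain ⟨T, hT⟩ := exists_path_through_of_sameComponent hl hld
      refine ⟨T, fun t ht i k s hk _ hs his hlk => ?_⟩
      obtain ⟨a, b, hab, h1, h2⟩ := hT t ht i k s hs his hlk
      exact ⟨a, b, d, k, ⟨hRmono d l hlR hld.2, m', hm', hdm⟩, hab, hk, h1, h2⟩
    -- Otherwise either `j` strongly accesses `l` and condition 1 gives μ ≤ λ(l), or neither
    -- strongly accesses the other and condition 2 gives λ(l) = μ.
    · have hlj : StronglyAccesses (digraph A) l j := by
        by_contra hn
        rcases Classical.em (StronglyAccesses (digraph A) j l) with hjl | hjl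
        · have := (h j l hjC hl).1 hjl.accesses
          exact hlμ (le_antisymm (hle l hlR) (hj ▸ this))
        · exact hlμ (((h l j hl hjC).2 ⟨hjl, hn⟩).trans hj.symm)
      obtain ⟨T, hT⟩ := exists_path_through_of_stronglyAccesses (hlj.trans hjc.1) hckc
      refine ⟨T, fun t ht i k s _ hsn _ his _ => ?_⟩
      obtain ⟨a, b, hab, h1, h2⟩ := hT t ht i s hsn his
      exact ⟨a, b, c, kc, ⟨hRmono c j hjR hjc.2, m, hm, hcm⟩, hab, hkc, h1, h2⟩
  choose! T hT using through
  obtain ⟨T₀, hT₀⟩ := exists_forall_mulVec_pow_add_eq (A := μ⁻¹ • A) (y := y) (C := C)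
    (jointCyclicity_pos A)
    (fun v k m hk hvk => by
      rw [hdig] at hvk
      rw [hpow]
      refine inv_mul_le_one_of_le₀ ((pow_le_nodeMcgm_pow v m).trans ?_) zero_le
      exact pow_le_pow_left' (hle v ((hmemR v).2 ⟨k, hk, hvk⟩)) m)
    (by
      rintro v ⟨hvR, m, hm, hvm⟩
      have hv : nodeMcgm A v = μ := by
        refine le_antisymm (hle v hvR) (le_of_pow_le_pow_left₀ (by omega : m ≠ 0) zero_le ?_)
        rw [← hvm]
        exact pow_le_nodeMcgm_pow v m
      obtain ⟨T, hT⟩ := exists_forall_pow_eq_nodeMcgm_pow hm (hvm.trans (by rw [hv]))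
      exact ⟨T, fun t ht hd => (hone _ _ _).2 (hv ▸ hT t ht hd)⟩)
    (fun v k m hk hvk hm hvm =>
      ⟨(hmemR v).2 ⟨k, hk, hdig ▸ hvk⟩, m, hm, (hone _ _ _).1 hvm⟩)
    (by
      refine ⟨n + Finset.univ.sup T, fun t ht i k hk hp => ?_⟩
      rw [← hasPath_digraph, hdig, hasPath_digraph] at hp
      obtain ⟨s, l, hs, hl, h1, h2⟩ := exists_onCycle_of_pow_ne_zero (by omega) hp
      have hTl : T l ≤ Finset.univ.sup T := Finset.le_sup (Finset.mem_univ l)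
      simp only [← hasPath_digraph, hdig] at h1 h2 ⊢
      exact hT l hl ((hmemR l).2 ⟨k, hk, _, h2⟩) t (by omega) i k s hk hs (by omega) h1 h2)
  refine ⟨μ, T₀, fun t ht => ?_⟩
  have := hT₀ t ht
  rw [pow_smul, pow_smul, smul_mulVec, smul_mulVec] at this
  have h2 := congrArg (fun z => μ ^ (t + jointCyclicity A) • z) this
  simp only [smul_smul, inv_pow, mul_inv_cancel₀ (hμt _), one_smul] at h2
  rw [h2, pow_add, mul_right_comm, mul_inv_cancel₀ (hμt _), one_mul]

end Sufficiency

/-! ### Necessity of the accessibility conditions -/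

section Necessity

variable {n : ℕ} {A : Matrix (Fin n) (Fin n) ℝ≥0}

lemma le_of_forall_mul_pow_le {a b δ D : ℝ≥0} (hδ : δ ≠ 0)
    (h : ∀ k : ℕ, δ * a ^ k ≤ D * b ^ k) : a ≤ b := by
  by_contra! hab
  have ha : a ≠ 0 := (zero_le.trans_lt hab).ne'
  have hlim : Filter.Tendsto (fun k : ℕ => D * (b / a) ^ k) Filter.atTop (nhds 0) := by
    simpa using (NNReal.tendsto_pow_atTop_nhds_zero_of_lt_one
      ((div_lt_one₀ (pos_of_ne_zero ha)).2 hab)).const_mul D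
  obtain ⟨k, hk⟩ := (hlim.eventually (gt_mem_nhds (pos_of_ne_zero hδ))).exists
  have h1 := h k
  rw [div_pow, ← mul_div_assoc, div_lt_iff₀ (pos_of_ne_zero (pow_ne_zero k ha))] at hk
  exact absurd h1 (not_le.2 hk)

/-- The weights of closed paths through `u` attain growth rate `nodeMcgm A u` along an
arithmetic progression. -/
lemma exists_mul_pow_le_pow {u : Fin n} (hu : OnCycle (digraph A) u) :
    ∃ δ m d, δ ≠ 0 ∧ 1 ≤ m ∧
      ∀ k : ℕ, δ * nodeMcgm A u ^ (k * m) ≤ pow A (d + k * m) u u := by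
  obtain ⟨c, m, ⟨⟨a, ha⟩, b, hb⟩, hm, hcm⟩ := exists_critical (nodeMcgm_ne_zero hu)
  rw [hasPath_digraph] at ha hb
  refine ⟨pow A a u c * pow A b c u, m, a + b, mul_ne_zero ha hb, hm, fun k => ?_⟩
  have hk : nodeMcgm A u ^ (k * m) ≤ pow A (k * m) c c := by
    induction k with
    | zero => simp [pow_zero_self]
    | succ k ih =>
      rw [add_mul, one_mul, pow_add]
      exact (mul_le_mul' ih hcm.ge).trans (pow_add_le _ _ _ _ _)
  calc pow A a u c * pow A b c u * nodeMcgm A u ^ (k * m)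
      = pow A a u c * nodeMcgm A u ^ (k * m) * pow A b c u := by ring
    _ ≤ pow A a u c * pow A (k * m) c c * pow A b c u := by gcongr
    _ ≤ pow A (a + k * m) u c * pow A b c u := mul_le_mul' (pow_add_le _ _ _ _ _) le_rfl
    _ ≤ pow A (a + b + k * m) u u := by
      have := pow_add_le (A := A) (a + k * m) b u c u
      rwa [show a + k * m + b = a + b + k * m by omega] at this

lemma eq_pow_mul_of_periodic {x : ℕ → ℝ≥0} {N T : ℕ} {r : ℝ≥0}
    (hx : ∀ t, T ≤ t → x (t + N) = r ^ N * x t) {t : ℕ} (ht : T ≤ t) (k : ℕ) :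
    x (t + k * N) = r ^ (k * N) * x t := by
  induction k with
  | zero => simp
  | succ k ih =>
    rw [show t + (k + 1) * N = t + k * N + N by ring, hx _ (by omega), ih, ← mul_assoc, ← pow_add]
    congr 2
    ring

/-- A periodic sequence dominating the closed path weights at `u` grows at least at rate
`nodeMcgm A u`. -/
lemma nodeMcgm_le_of_periodic {x : ℕ → ℝ≥0} {N T p : ℕ} (hN : 0 < N) {r δ : ℝ≥0}
    (hx : ∀ t, T ≤ t → x (t + N) = r ^ N * x t) {u : Fin n} (hu : OnCycle (digraph A) u)
    (hδ : δ ≠ 0) (h : ∀ t, δ * pow A t u u ≤ x (t + p)) : nodeMcgm A u ≤ r := by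
  obtain ⟨η, m, d, hη, hm, hle⟩ := exists_mul_pow_le_pow hu
  have hTm : T ≤ T * m := Nat.le_mul_of_pos_right _ hm
  -- The comparison is made at the times `d + (T + k * N) * m + p`: the shift `T * m` passes the
  -- threshold, and each step in `k` advances by `m` full periods of `x`.
  refine le_of_pow_le_pow_left₀ (mul_pos hm hN).ne' zero_le
    (le_of_forall_mul_pow_le (δ := δ * η * nodeMcgm A u ^ (T * m)) (D := x (d + T * m + p))
      (mul_ne_zero (mul_ne_zero hδ hη) (pow_ne_zero _ (nodeMcgm_ne_zero hu))) fun k => ?_)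
  have h1 := eq_pow_mul_of_periodic hx (t := d + T * m + p) (by omega) (k * m)
  have h2 := hle (T + k * N)
  calc δ * η * nodeMcgm A u ^ (T * m) * (nodeMcgm A u ^ (m * N)) ^ k
      = δ * (η * nodeMcgm A u ^ ((T + k * N) * m)) := by
        rw [show (T + k * N) * m = T * m + m * N * k by ring, pow_add, pow_mul _ (m * N) k]
        ring
    _ ≤ δ * pow A (d + (T + k * N) * m) u u := by gcongr
    _ ≤ x (d + (T + k * N) * m + p) := h _
    _ = x (d + T * m + p) * (r ^ (m * N)) ^ k := by
      rw [show d + (T + k * N) * m + p = d + T * m + p + k * m * N by ring, h1, ← pow_mul,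
        mul_comm]
      congr 2
      ring

/-- A periodic sequence agreeing with the closed path weights at `u` whenever these do not vanish
grows at rate `nodeMcgm A u`. -/
lemma nodeMcgm_eq_of_periodic {x : ℕ → ℝ≥0} {N T : ℕ} (hN : 0 < N) {r : ℝ≥0}
    (hx : ∀ t, T ≤ t → x (t + N) = r ^ N * x t) {u : Fin n} (hu : OnCycle (digraph A) u)
    (h : ∀ t, pow A t u u ≠ 0 → x t = pow A t u u) : nodeMcgm A u = r := by
  have hle : ∀ t, pow A t u u ≤ x t := by
    intro t
    rcases eq_or_ne (pow A t u u) 0 with h0 | h0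
    · simp [h0]
    · exact (h t h0).ge
  refine le_antisymm (nodeMcgm_le_of_periodic (p := 0) hN hx hu one_ne_zero (by simpa using hle)) ?_
  obtain ⟨m, hm, hp⟩ := hu
  have hTm : T ≤ T * m := Nat.le_mul_of_pos_right _ hm
  -- At multiples of `m` the closed path weights do not vanish, so `x` coincides with them there and
  -- inherits their upper bound.
  have hne : ∀ s, pow A (s * m) u u ≠ 0 := fun s => hasPath_digraph.1 (hp.mul_left s)
  refine le_of_pow_le_pow_left₀ (mul_pos hm hN).ne' zero_le
    (le_of_forall_mul_pow_le (δ := x (T * m)) (D := nodeMcgm A u ^ (T * m)) ?_ fun k => ?_)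
  · rw [h _ (hne T)]
    exact hne T
  have h1 := eq_pow_mul_of_periodic hx hTm (k * m)
  have h2 := h _ (hne (T + k * N))
  calc x (T * m) * (r ^ (m * N)) ^ k = x (T * m + k * m * N) := by
        rw [h1, ← pow_mul, mul_comm]
        congr 2
        ring
    _ = pow A ((T + k * N) * m) u u := by
        rw [← h2]
        congr 1
        ring
    _ ≤ nodeMcgm A u ^ ((T + k * N) * m) := pow_le_nodeMcgm_pow _ _
    _ = nodeMcgm A u ^ (T * m) * (nodeMcgm A u ^ (m * N)) ^ k := by
        rw [show (T + k * N) * m = T * m + m * N * k by ring, pow_add, pow_mul _ (m * N) k]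

lemma mulVec_unitVec_sup (M : Matrix (Fin n) (Fin n) ℝ≥0) (i j u : Fin n) :
    mulVec M (unitVec i ⊔ unitVec j) u = M u i ⊔ M u j := by
  have hk : ∀ k, (unitVec i ⊔ unitVec j : Fin n → ℝ≥0) k = if k = i ∨ k = j then 1 else 0 := by
    intro k
    simp only [unitVec, Pi.sup_apply, Pi.single_apply]
    split_ifs <;> simp_all
  apply le_antisymm
  · obtain ⟨k, h⟩ := exists_mulVec_apply M (unitVec i ⊔ unitVec j) u
    rw [h, hk]
    split_ifs with hc
    · rcases hc with rfl | rfl <;> simp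
    · simp
  · refine sup_le ?_ ?_
    · have := le_mulVec M (unitVec i ⊔ unitVec j) u i
      rwa [hk, if_pos (.inl rfl), mul_one] at this
    · have := le_mulVec M (unitVec i ⊔ unitVec j) u j
      rwa [hk, if_pos (.inr rfl), mul_one] at this

lemma UltimatelyLinearPeriodic.exists_unitVec {i j : Fin n}
    (h : UltimatelyLinearPeriodic A (unitVec i ⊔ unitVec j)) :
    ∃ r T, ∀ u t, T ≤ t → pow A (t + jointCyclicity A) u i ⊔ pow A (t + jointCyclicity A) u j =
      r ^ jointCyclicity A * (pow A t u i ⊔ pow A t u j) := by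
  obtain ⟨r, T, hT⟩ := h
  refine ⟨r, T, fun u t ht => ?_⟩
  have := congrFun (hT t ht) u
  rwa [Pi.smul_apply, mulVec_unitVec_sup, mulVec_unitVec_sup, smul_eq_mul] at this

/-- In the orbit of `e_j`, coordinate `j` has rate λ(j), while coordinate `i` has rate at least
λ(i): run round closed paths at `i`, then go to `j`. -/
lemma nodeMcgm_le_of_accesses {i j : Fin n} (hi : OnCycle (digraph A) i)
    (hj : OnCycle (digraph A) j) (h : UltimatelyLinearPeriodic A (unitVec j ⊔ unitVec j))
    (hij : Accesses (digraph A) i j) : nodeMcgm A i ≤ nodeMcgm A j := by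
  obtain ⟨r, T, hT⟩ := h.exists_unitVec
  obtain ⟨p, hp⟩ := hij
  have hr : nodeMcgm A j = r :=
    nodeMcgm_eq_of_periodic (jointCyclicity_pos A) (hT j) hj fun t _ => sup_idem _
  rw [hr]
  refine nodeMcgm_le_of_periodic (x := fun t => pow A t i j ⊔ pow A t i j) (p := p)
    (jointCyclicity_pos A) (hT i) hi
    (hasPath_digraph.1 hp) fun t => ?_
  simp only [sup_idem]
  rw [mul_comm]
  exact pow_add_le _ _ _ _ _

/-- For a suitable `i'` in the component of `i`, coordinate `i'` of the orbit of `e_i' ⊕ e_j` does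
not see `j` at any length of a closed path at `i'`, so its rate is λ(i). Coordinate `j` never sees
`i'`, so its rate is λ(j). -/
lemma nodeMcgm_eq_of_not_accesses {i j : Fin n} (hi : OnCycle (digraph A) i)
    (hj : OnCycle (digraph A) j)
    (h : ∀ i, OnCycle (digraph A) i → UltimatelyLinearPeriodic A (unitVec i ⊔ unitVec j))
    (hij : ¬ StronglyAccesses (digraph A) i j) (hji : ¬ Accesses (digraph A) j i) :
    nodeMcgm A i = nodeMcgm A j := by
  obtain ⟨i', hs, hi'⟩ := hi.exists_of_not_stronglyAccesses hij
  obtain ⟨r, T, hT⟩ := (h i' (hs.onCycle hi)).exists_unitVec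
  have h1 : nodeMcgm A i' = r := by
    refine nodeMcgm_eq_of_periodic (x := fun t => pow A t i' i' ⊔ pow A t i' j)
      (jointCyclicity_pos A) (hT i') (hs.onCycle hi) fun t ht => ?_
    have h0 : pow A t i' j = 0 := by
      by_contra hne
      exact hi' t (hasPath_digraph.2 ht) (hasPath_digraph.2 hne)
    simp [h0]
  have h2 : nodeMcgm A j = r := by
    refine nodeMcgm_eq_of_periodic (x := fun t => pow A t j i' ⊔ pow A t j j)
      (jointCyclicity_pos A) (hT j) hj fun t _ => ?_
    have h0 : pow A t j i' = 0 := by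
      by_contra hne
      exact hji ((hasPath_digraph.2 hne).accesses.trans hs.2)
    simp [h0]
  rw [nodeMcgm_congr hs, h1, h2]

theorem conditions_of_ultimatelyLinearPeriodic
    (h : ∀ i j : Fin n, OnCycle (digraph A) i → OnCycle (digraph A) j →
      UltimatelyLinearPeriodic A (unitVec i ⊔ unitVec j)) (i j : Fin n)
    (hi : OnCycle (digraph A) i) (hj : OnCycle (digraph A) j) :
    (Accesses (digraph A) i j → nodeMcgm A i ≤ nodeMcgm A j) ∧
      (¬ StronglyAccesses (digraph A) j i ∧ ¬ StronglyAccesses (digraph A) i j →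
        nodeMcgm A i = nodeMcgm A j) := by
  refine ⟨nodeMcgm_le_of_accesses hi hj (h j j hj hj), fun ⟨hji, hij⟩ => ?_⟩
  -- Mutual access means one component; otherwise one of the two accesses fails, which is the
  -- preceding lemma up to swapping the nodes.
  by_cases h1 : Accesses (digraph A) j i
  · by_cases h2 : Accesses (digraph A) i j
    · exact nodeMcgm_congr ⟨h2, h1⟩
    · exact (nodeMcgm_eq_of_not_accesses hj hi (fun l hl => h l i hl hi) hji h2).symm
  · exact nodeMcgm_eq_of_not_accesses hi hj (fun l hl => h l j hl hj) hij h1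

end Necessity

end MaxAlgebra

/-- `e_i ⊕ e_j` is the pointwise maximum `unitVec i ⊔ unitVec j`. -/
theorem theorem7p4 {n : ℕ} (A : Matrix (Fin n) (Fin n) ℝ≥0) :
    (MaxAlgebra.OrbitPeriodic A ↔
      ∀ i j : Fin n, MaxAlgebra.OnCycle (MaxAlgebra.digraph A) i →
        MaxAlgebra.OnCycle (MaxAlgebra.digraph A) j →
        (MaxAlgebra.Accesses (MaxAlgebra.digraph A) i j →
          MaxAlgebra.nodeMcgm A i ≤ MaxAlgebra.nodeMcgm A j) ∧
        (¬ MaxAlgebra.StronglyAccesses (MaxAlgebra.digraph A) j i ∧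
            ¬ MaxAlgebra.StronglyAccesses (MaxAlgebra.digraph A) i j →
          MaxAlgebra.nodeMcgm A i = MaxAlgebra.nodeMcgm A j)) ∧
    (MaxAlgebra.OrbitPeriodic A ↔
      ∀ i j : Fin n, MaxAlgebra.OnCycle (MaxAlgebra.digraph A) i →
        MaxAlgebra.OnCycle (MaxAlgebra.digraph A) j →
        MaxAlgebra.UltimatelyLinearPeriodic A
          (MaxAlgebra.unitVec i ⊔ MaxAlgebra.unitVec j)) := by
  exact ⟨⟨fun h => MaxAlgebra.conditions_of_ultimatelyLinearPeriodic fun i j _ _ => h _,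
    fun h => MaxAlgebra.ultimatelyLinearPeriodic_of_conditions h⟩,
   ⟨fun h i j _ _ => h _, fun h => MaxAlgebra.ultimatelyLinearPeriodic_of_conditions
    (MaxAlgebra.conditions_of_ultimatelyLinearPeriodic h)⟩⟩
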